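/- Let $n,m\in\mathbb N$ and let $f,g_1,\dots,g_m\in\mathbb R[x_1,\dots,x_n]$ be the data of the polynomial optimization problem of minimizing $f(x)$ over $K=\{x\in\mathbb R^n: g_i(x)\ge 0,\ i=1,\dots,m\}$. Put $g_0=1$, let $d_i=\lceil \deg(g_i)/2\rceil$ (with the degree of the zero polynomial taken to be $0$) and $d_{\min}=\max_{0\le i\le m} d_i$. For $d\ge d_{\min}$, $0\le i\le m$ and a real vector $y=(y_\alpha)_{\alpha\in\mathbb N^n,\,|\alpha|\le 2d}$, let $$M_{d-d_i}(g_iy)=\Big(\sum_\gamma g_{i,\gamma}\,y_{\alpha+\beta+\gamma}\Big)_{|\alpha|,|\beta|\le d-d_i}=\sum_{|\alpha|\le 2d}A_{i,\alpha}\,y_\alpha ,$$ which defines the symmetric matrices $A_{i,\alpha}$. Consider the moment problem $$(P_d)\qquad \inf_y\ \sum_{|\alpha|\le 2d} f_\alpha y_\alpha\quad\text{s.t.}\quad y_0=1,\quad M_{d-d_i}(g_iy)\succeq 0,\ i=0,\dots,m,$$ and its dual sum-of-squares problem $$(D_d)\qquad \sup_{z\in\mathbb R,\ Z_0,\dots,Z_m}\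 z\quad\text{s.t.}\quad f_0-z=\sum_{i=0}^m\langle A_{i,0},Z_i\rangle,\quad f_\alpha=\sum_{i=0}^m\langle A_{i,\alpha},Z_i\rangle\ \ (0<|\alpha|\le 2d),\quad Z_i\succeq 0,\ i=0,\dots,m,$$ where $\langle A,B\rangle=\operatorname{trace}(AB)$ and each $Z_i$ is a real symmetric matrix of the size of $M_{d-d_i}(g_iy)$. Let $\operatorname{val}P_d$ and $\operatorname{val}D_d$ in $[-\infty,+\infty]$ be their optimal values, with $\inf\emptyset=+\infty$ and $\sup\emptyset=-\infty$. Suppose that one of the constraint polynomials $g_1,\dots,g_m$ equals $R^2-\sum_{i=1}^n x_i^2$ for some real number $R$. Then, for every integer $d\ge d_{\min}$, $$-\infty<\operatorname{val}P_d=\operatorname{val}D_d .$$ In particular, if $P_d$ is infeasible, then $\operatorname{val}P_d=\operatorname{val}D_d=+\infty$. (No interior point of $K$ is assumed to exist.) -/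

import Mathlib

noncomputable section

namespace Lasserre

/-- Multi-indices `α ∈ ℕⁿ` with `|α| = α₁ + ⋯ + αₙ ≤ k`. -/
abbrev MultiIndex (n k : ℕ) : Type := {α : Fin n →₀ ℕ // α.degree ≤ k}

instance MultiIndex.finite (n k : ℕ) : Finite (MultiIndex n k) :=
  (Finsupp.finite_of_degree_le (σ := Fin n) k).to_subtype

instance MultiIndex.fintype (n k : ℕ) : Fintype (MultiIndex n k) := Fintype.ofFinite _

/-- The multi-index `0`. -/
def MultiIndex.zero (n k : ℕ) : MultiIndex n k := ⟨0, by simp⟩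

/-- The smallest integer greater than or equal to half the degree of `p`. -/
def halfDegree {n : ℕ} (p : MvPolynomial (Fin n) ℝ) : ℕ := (p.totalDegree + 1) / 2

/-- The constraint polynomials `g₀ = 1, g₁, …, gₘ`. -/
def constraints {n m : ℕ} (g : Fin m → MvPolynomial (Fin n) ℝ) :
    Fin (m + 1) → MvPolynomial (Fin n) ℝ :=
  Fin.cons 1 g

/-- `d_min`, the maximum of the half-degrees `dᵢ` for `i = 0, …, m`. -/
def minOrder {n m : ℕ} (g : Fin m → MvPolynomial (Fin n) ℝ) : ℕ :=
  Finset.univ.sup fun i => halfDegree (constraints g i)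

/-- The entry `y_δ` of a sequence `y` indexed by the `δ` with `|δ| ≤ k` (and `0` for the other `δ`).
In the localizing matrices of order `d ≥ d_min` below only indices with `|δ| ≤ 2d` occur. -/
def entry {n k : ℕ} (y : MultiIndex n k → ℝ) (δ : Fin n →₀ ℕ) : ℝ :=
  if h : δ.degree ≤ k then y ⟨δ, h⟩ else 0

/-- The localizing matrix `M_{d - dₚ}(p y)`, where `dₚ = halfDegree p`: its `(α, β)` entry, for
`|α|, |β| ≤ d - dₚ`, is `∑_γ p_γ y_{α+β+γ}`. For `p = 1` it is the moment matrix `M_d(y)`. -/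
def localizingMatrix {n : ℕ} (d : ℕ) (p : MvPolynomial (Fin n) ℝ)
    (y : MultiIndex n (2 * d) → ℝ) :
    Matrix (MultiIndex n (d - halfDegree p)) (MultiIndex n (d - halfDegree p)) ℝ :=
  Matrix.of fun α β => ∑ γ ∈ p.support, p.coeff γ * entry y (α.1 + β.1 + γ)

/-- The matrix `A_δ` in `M_{d - dₚ}(p y) = ∑_{|δ| ≤ 2d} y_δ A_δ`: its `(α, β)` entry is the sum
of the coefficients `p_γ` over the `γ` with `α + β + γ = δ`. -/
def coeffMatrix {n : ℕ} (d : ℕ) (p : MvPolynomial (Fin n) ℝ) (δ : Fin n →₀ ℕ) :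
    Matrix (MultiIndex n (d - halfDegree p)) (MultiIndex n (d - halfDegree p)) ℝ :=
  Matrix.of fun α β => ∑ γ ∈ p.support, if α.1 + β.1 + γ = δ then p.coeff γ else 0

/-- The feasible set of the moment problem `P_d`. -/
def primalFeasible {n m : ℕ} (g : Fin m → MvPolynomial (Fin n) ℝ) (d : ℕ) :
    Set (MultiIndex n (2 * d) → ℝ) :=
  {y | y (MultiIndex.zero n (2 * d)) = 1 ∧
    ∀ i, (localizingMatrix d (constraints g i) y).PosSemidef}

/-- The objective `∑_α f_α y_α` of `P_d`, over the indices `|α| ≤ 2d` of the variable `y`. -/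
def primalObjective {n : ℕ} (f : MvPolynomial (Fin n) ℝ) (d : ℕ)
    (y : MultiIndex n (2 * d) → ℝ) : ℝ :=
  ∑ α, f.coeff α.1 * y α

/-- The optimal value of `P_d`, equal to `+∞` if `P_d` is infeasible. -/
def valP {n m : ℕ} (f : MvPolynomial (Fin n) ℝ) (g : Fin m → MvPolynomial (Fin n) ℝ) (d : ℕ) :
    EReal :=
  ⨅ y ∈ primalFeasible g d, (primalObjective f d y : EReal)

/-- A dual variable `(Z₀, …, Zₘ)`. -/
abbrev DualMatrices {n m : ℕ} (g : Fin m → MvPolynomial (Fin n) ℝ) (d : ℕ) : Type :=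
  (i : Fin (m + 1)) →
    Matrix (MultiIndex n (d - halfDegree (constraints g i)))
      (MultiIndex n (d - halfDegree (constraints g i))) ℝ

/-- The feasible set of the sum-of-squares problem `D_d`, where `⟨A, B⟩ = trace (A B)`. -/
def dualFeasible {n m : ℕ} (f : MvPolynomial (Fin n) ℝ) (g : Fin m → MvPolynomial (Fin n) ℝ)
    (d : ℕ) : Set (ℝ × DualMatrices g d) :=
  {w | f.coeff 0 - w.1 = ∑ i, (coeffMatrix d (constraints g i) 0 * w.2 i).trace ∧
    (∀ α : Fin n →₀ ℕ, 0 < α.degree → α.degree ≤ 2 * d →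
      f.coeff α = ∑ i, (coeffMatrix d (constraints g i) α * w.2 i).trace) ∧
    ∀ i, (w.2 i).PosSemidef}

/-- The optimal value of `D_d`, equal to `-∞` if `D_d` is infeasible. -/
def valD {n m : ℕ} (f : MvPolynomial (Fin n) ℝ) (g : Fin m → MvPolynomial (Fin n) ℝ) (d : ℕ) :
    EReal :=
  ⨆ w ∈ dualFeasible f g d, (w.1 : EReal)

/-- One of the constraints `gⱼ ≥ 0` is a ball constraint `R² - ∑ᵢ xᵢ² ≥ 0`. -/
def HasBallConstraint {n m : ℕ} (g : Fin m → MvPolynomial (Fin n) ℝ) : Prop :=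
  ∃ (j : Fin m) (R : ℝ), g j = MvPolynomial.C (R ^ 2) - ∑ i, MvPolynomial.X i ^ 2

end Lasserre

end

/-! Identify polynomials with their coefficient vectors up to degree 2d, and let Q be the cone of
truncated sums of `gᵢσᵢ`. Dual feasibility of z says f - z·1 ∈ Q, and the feasible y are exactly the
functionals L ≥ 0 on Q with L(1) = 1; weak duality follows. For the converse, the ball constraint
makes 1 an order unit of Q: every x satisfies N·1 - x ∈ Q for some N (`exists_smul_one_sub_mem`).
Hence D_d is feasible, and the M. Riesz extension theorem gives, for each real c > val D_d, a
feasible L with L(f) ≤ c (`exists_state_le`). This needs neither closedness of Q nor an interior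
point of K. If P_d is infeasible, no such c exists, so val D_d = +∞. -/

namespace Lasserre

open Matrix MvPolynomial

/-! ### Conic duality with an order unit -/

section ConeDuality

variable {E : Type*} [AddCommGroup E] [Module ℝ E]

/-- The convex cone generated by a pointed cone and one more vector. -/
def adjoinRay (Q : PointedCone ℝ E) (v : E) : PointedCone ℝ E :=
  Q ⊔ Submodule.span _ {v}

theorem mem_adjoinRay {Q : PointedCone ℝ E} {v x : E} :
    x ∈ adjoinRay Q v ↔ ∃ q ∈ Q, ∃ t : ℝ, 0 ≤ t ∧ q + t • v = x := by
  rw [adjoinRay, Submodule.mem_sup]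
  constructor
  · rintro ⟨q, hq, w, hw, rfl⟩
    obtain ⟨t, rfl⟩ := Submodule.mem_span_singleton.1 hw
    exact ⟨q, hq, t, t.2, rfl⟩
  · rintro ⟨q, hq, t, ht, rfl⟩
    exact ⟨q, hq, _, Submodule.mem_span_singleton.2 ⟨⟨t, ht⟩, rfl⟩, rfl⟩

/-- If `e` is an order unit of a proper cone, then some state is nonnegative on the cone. -/
theorem exists_state_of_neg_notMem (Q : PointedCone ℝ E) (e : E)
    (hunit : ∀ x : E, ∃ N : ℝ, N • e - x ∈ Q) (hneg : -e ∉ Q) :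
    ∃ L : E →ₗ[ℝ] ℝ, L e = 1 ∧ ∀ x ∈ Q, 0 ≤ L x := by
  have he : e ≠ 0 := by
    rintro rfl
    exact hneg (by simp)
  -- Extend c • e ↦ c from the line through e. A negative multiple of e in Q would rescale to -e,
  -- and the order unit supplies the cofinality hypothesis.
  obtain ⟨L, hLe, hLQ⟩ := riesz_extension Q (LinearPMap.mkSpanSingleton e (1 : ℝ) he) (by
    rintro ⟨x, hx⟩ hxQ
    obtain ⟨c, rfl⟩ := Submodule.mem_span_singleton.1 hx
    have hval : LinearPMap.mkSpanSingleton e (1 : ℝ) he ⟨c • e, hx⟩ = c • (1 : ℝ) :=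
      LinearPMap.mkSpanSingleton'_apply _ _ _ _ _
    rw [hval]
    by_contra! hc
    have hc : c < 0 := by simpa using hc
    refine hneg ?_
    have := Q.smul_mem (r := -c⁻¹) (by simpa using hc.le) hxQ
    simpa [smul_smul, hc.ne] using this) (by
    intro y
    obtain ⟨N, hN⟩ := hunit (-y)
    exact ⟨⟨N • e, Submodule.mem_span_singleton.2 ⟨N, rfl⟩⟩, by simpa using hN⟩)
  refine ⟨L, ?_, hLQ⟩
  have := hLe ⟨e, Submodule.mem_span_singleton_self e⟩
  rwa [LinearPMap.mkSpanSingleton_apply] at this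

/-- Conic duality in the presence of an order unit `e`: an upper bound for the `t` with
`x - t e` in the cone is at least the value at `x` of some state. -/
theorem exists_state_le (Q : PointedCone ℝ E) (e : E)
    (hunit : ∀ x : E, ∃ N : ℝ, N • e - x ∈ Q) (x : E) (c : ℝ)
    (hc : ∀ t, c < t → x - t • e ∉ Q) :
    ∃ L : E →ₗ[ℝ] ℝ, L e = 1 ∧ (∀ q ∈ Q, 0 ≤ L q) ∧ L x ≤ c := by
  -- A state nonnegative on c • e - x satisfies L x ≤ c, so this vector is adjoined to Q.
  obtain ⟨L, hLe, hL⟩ := exists_state_of_neg_notMem (adjoinRay Q (c • e - x)) e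
    (fun y ↦ (hunit y).imp fun N hN ↦ mem_adjoinRay.2 ⟨_, hN, 0, le_rfl, by simp⟩) (by
    intro h
    obtain ⟨q, hq, t, ht, h⟩ := mem_adjoinRay.1 h
    rcases ht.eq_or_lt with rfl | ht
    -- Here -e ∈ Q, so x - t • e ∈ Q for all large t; the maximum gives both t > c and t ≥ -N.
    · obtain ⟨N, hN⟩ := hunit (-x)
      have hq' : -e ∈ Q := by simpa [← h] using hq
      refine hc (max c (-N) + 1) (by linarith [le_max_left c (-N)]) ?_
      have := Q.add_mem hN (Q.smul_mem (r := max c (-N) + 1 + N)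
        (by linarith [le_max_right c (-N)]) hq')
      convert this using 1
      module
    · refine hc (c + t⁻¹) (by linarith [inv_pos.2 ht]) ?_
      have := Q.smul_mem (inv_nonneg.2 ht.le) hq
      rw [← eq_sub_iff_add_eq] at h
      rw [h] at this
      convert this using 1
      rw [smul_sub, smul_smul, inv_mul_cancel₀ ht.ne']
      module)
  refine ⟨L, hLe, fun q hq ↦ hL q (mem_adjoinRay.2 ⟨q, hq, 0, le_rfl, by simp⟩), ?_⟩
  have := hL _ (mem_adjoinRay.2 ⟨0, Q.zero_mem, 1, zero_le_one, by simp⟩ : c • e - x ∈ _)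
  simpa [hLe] using this

end ConeDuality

/-! ### Coefficient vectors and the truncated quadratic module -/

section Truncation

variable {n m : ℕ}

/-- The coefficients of a polynomial at the multi-indices of degree at most `k`. -/
noncomputable def truncation (n k : ℕ) : MvPolynomial (Fin n) ℝ →ₗ[ℝ] (MultiIndex n k → ℝ) :=
  LinearMap.pi fun α ↦ MvPolynomial.lcoeff ℝ α.1

@[simp]
theorem truncation_apply {k : ℕ} (p : MvPolynomial (Fin n) ℝ) (α : MultiIndex n k) :
    truncation n k p α = p.coeff α.1 := rfl

theorem eq_sum_smul_truncation_monomial {k : ℕ} (x : MultiIndex n k → ℝ) :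
    x = ∑ α, x α • truncation n k (monomial α.1 1) := by
  classical
  ext β
  simp [coeff_monomial, ← Subtype.ext_iff]

theorem sum_monomial_coeff {k : ℕ} {s : MvPolynomial (Fin n) ℝ} (hs : s.totalDegree ≤ k) :
    ∑ α : MultiIndex n k, monomial α.1 (s.coeff α.1) = s := by
  classical
  ext δ
  simp only [coeff_sum, coeff_monomial]
  by_cases h : δ.degree ≤ k
  · rw [Finset.sum_eq_single ⟨δ, h⟩] <;> simp +contextual [Subtype.ext_iff]
  · rw [Finset.sum_eq_zero, coeff_eq_zero_of_totalDegree_lt]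
    · exact hs.trans_lt (not_le.1 h)
    · rintro α -
      rw [if_neg]
      rintro rfl
      exact h α.2

/-- The coefficients up to degree `2d` of `∑ᵢ gᵢ σᵢ`, where `σᵢ` is the polynomial with Gram
matrix `Zᵢ`. -/
noncomputable def sosMap (g : Fin m → MvPolynomial (Fin n) ℝ) (d : ℕ) :
    DualMatrices g d →ₗ[ℝ] (MultiIndex n (2 * d) → ℝ) where
  toFun Z α := ∑ i, (coeffMatrix d (constraints g i) α.1 * Z i).trace
  map_add' Z W := by
    ext α
    simp [Matrix.mul_add, Finset.sum_add_distrib]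
  map_smul' c Z := by
    ext α
    simp [Finset.mul_sum]

theorem sosMap_apply (g : Fin m → MvPolynomial (Fin n) ℝ) (d : ℕ) (Z : DualMatrices g d)
    (α : MultiIndex n (2 * d)) :
    sosMap g d Z α = ∑ i, (coeffMatrix d (constraints g i) α.1 * Z i).trace := rfl

/-- The truncated quadratic module of order `d`. -/
noncomputable def sosCone (g : Fin m → MvPolynomial (Fin n) ℝ) (d : ℕ) :
    PointedCone ℝ (MultiIndex n (2 * d) → ℝ) where
  carrier := {x | ∃ Z : DualMatrices g d, (∀ i, (Z i).PosSemidef) ∧ sosMap g d Z = x}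
  add_mem' := by
    rintro _ _ ⟨Z, hZ, rfl⟩ ⟨W, hW, rfl⟩
    exact ⟨Z + W, fun i ↦ (hZ i).add (hW i), map_add _ _ _⟩
  zero_mem' := ⟨0, fun _ ↦ .zero, map_zero _⟩
  smul_mem' := by
    rintro c _ ⟨Z, hZ, rfl⟩
    exact ⟨c.1 • Z, fun i ↦ (hZ i).smul c.2, map_smul _ _ _⟩

theorem mem_sosCone {g : Fin m → MvPolynomial (Fin n) ℝ} {d : ℕ}
    {x : MultiIndex n (2 * d) → ℝ} :
    x ∈ sosCone g d ↔ ∃ Z : DualMatrices g d, (∀ i, (Z i).PosSemidef) ∧ sosMap g d Z = x :=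
  Iff.rfl

/-- Only the equation at index 0 involves z, so all of them merge into one vector identity with
right-hand side f - z·1. -/
theorem mem_dualFeasible {f : MvPolynomial (Fin n) ℝ} {g : Fin m → MvPolynomial (Fin n) ℝ}
    {d : ℕ} {z : ℝ} {Z : DualMatrices g d} :
    (z, Z) ∈ dualFeasible f g d ↔
      (∀ i, (Z i).PosSemidef) ∧
        sosMap g d Z = truncation n (2 * d) f - z • truncation n (2 * d) 1 := by
  classical
  constructor
  · rintro ⟨h0, hα, hZ⟩
    refine ⟨hZ, funext fun α ↦ ?_⟩
    rw [sosMap_apply]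
    by_cases h : α.1 = 0
    · simp [h, ← h0]
    · have := hα α.1 (Nat.pos_of_ne_zero fun h' ↦ h ((Finsupp.degree_eq_zero_iff _).1 h')) α.2
      simp [← this, coeff_one, Ne.symm h]
  · rintro ⟨hZ, h⟩
    have key (α : MultiIndex n (2 * d)) := congrFun h α
    simp only [sosMap_apply] at key
    refine ⟨?_, fun α hα hα' ↦ ?_, hZ⟩
    · simpa [MultiIndex.zero] using (key (MultiIndex.zero n (2 * d))).symm
    · have hne : (0 : Fin n →₀ ℕ) ≠ α := by
        rintro rfl
        simp at hα
      simpa [coeff_one, hne] using (key ⟨α, hα'⟩).symm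

theorem exists_mem_dualFeasible_iff {f : MvPolynomial (Fin n) ℝ}
    {g : Fin m → MvPolynomial (Fin n) ℝ} {d : ℕ} {z : ℝ} :
    (∃ Z, (z, Z) ∈ dualFeasible f g d) ↔
      truncation n (2 * d) f - z • truncation n (2 * d) 1 ∈ sosCone g d := by
  simp only [mem_dualFeasible, mem_sosCone]

/-! ### Pairing of localizing and Gram matrices -/

theorem sum_entry {k : ℕ} (y : MultiIndex n k → ℝ) (δ : Fin n →₀ ℕ) (c : ℝ) :
    ∑ α : MultiIndex n k, (if δ = α.1 then c else 0) * y α = c * entry y δ := by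
  classical
  by_cases h : δ.degree ≤ k
  · rw [Finset.sum_eq_single ⟨δ, h⟩]
    · simp [entry, h]
    · intro α _ hα
      rw [if_neg fun h' ↦ hα (Subtype.ext h'.symm), zero_mul]
    · simp
  · rw [entry, dif_neg h, mul_zero]
    refine Finset.sum_eq_zero fun α _ ↦ ?_
    rw [if_neg, zero_mul]
    rintro rfl
    exact h α.2

theorem localizingMatrix_eq_sum (d : ℕ) (p : MvPolynomial (Fin n) ℝ)
    (y : MultiIndex n (2 * d) → ℝ) :
    localizingMatrix d p y = ∑ α, y α • coeffMatrix d p α.1 := by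
  ext a b
  simp only [localizingMatrix, coeffMatrix, Matrix.of_apply, Matrix.sum_apply, Matrix.smul_apply,
    smul_eq_mul, Finset.mul_sum]
  rw [Finset.sum_comm]
  refine Finset.sum_congr rfl fun γ _ ↦ ?_
  rw [← sum_entry]
  exact Finset.sum_congr rfl fun α _ ↦ mul_comm _ _

/-- Adjointness of `sosMap` and the localizing matrices, which links nonnegativity on the cone to
positive semidefiniteness. -/
theorem sum_sosMap_mul (g : Fin m → MvPolynomial (Fin n) ℝ) (d : ℕ) (Z : DualMatrices g d)
    (y : MultiIndex n (2 * d) → ℝ) :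
    ∑ α, sosMap g d Z α * y α = ∑ i, (localizingMatrix d (constraints g i) y * Z i).trace := by
  simp only [sosMap_apply, localizingMatrix_eq_sum, Finset.sum_mul,
    Matrix.trace_sum, Matrix.smul_mul, Matrix.trace_smul, smul_eq_mul]
  rw [Finset.sum_comm]
  simp only [mul_comm]

theorem trace_mul_vecMulVec {ι : Type*} [Fintype ι] (A : Matrix ι ι ℝ) (v : ι → ℝ) :
    (A * vecMulVec v v).trace = ∑ a, ∑ b, A a b * (v a * v b) := by
  simp only [Matrix.trace, Matrix.diag, Matrix.mul_apply, vecMulVec_apply]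
  exact Finset.sum_congr rfl fun a _ ↦ Finset.sum_congr rfl fun b _ ↦ by ring

/-- Writing B as a sum of matrices v vᵀ turns the trace into a sum of values vᵀ A v. -/
theorem trace_mul_nonneg {ι : Type*} [Fintype ι] {A B : Matrix ι ι ℝ}
    (hA : A.PosSemidef) (hB : B.PosSemidef) : 0 ≤ (A * B).trace := by
  obtain ⟨k, v, rfl⟩ := posSemidef_iff_eq_sum_vecMulVec.1 hB
  rw [Matrix.mul_sum, Matrix.trace_sum]
  refine Finset.sum_nonneg fun i _ ↦ ?_
  have := hA.dotProduct_mulVec_nonneg (v i)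
  rw [show star (v i) = v i from rfl] at this ⊢
  rw [trace_mul_vecMulVec]
  convert this using 1
  simp only [dotProduct, mulVec, Finset.mul_sum]
  exact Finset.sum_congr rfl fun a _ ↦ Finset.sum_congr rfl fun b _ ↦ by ring

theorem coeff_mul_monomial_eq_sum (p : MvPolynomial (Fin n) ℝ) (s δ : Fin n →₀ ℕ) (c : ℝ) :
    (p * monomial s c).coeff δ = ∑ γ ∈ p.support, if s + γ = δ then p.coeff γ * c else 0 := by
  classical
  conv_lhs => rw [p.as_sum]
  rw [Finset.sum_mul, coeff_sum]
  refine Finset.sum_congr rfl fun γ _ ↦ ?_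
  rw [monomial_mul, coeff_monomial, add_comm γ]

/-- The Gram matrix v vᵀ represents the square of the polynomial with coefficients v. -/
theorem trace_coeffMatrix_mul_vecMulVec (d : ℕ) (p : MvPolynomial (Fin n) ℝ) (δ : Fin n →₀ ℕ)
    (v : MultiIndex n (d - halfDegree p) → ℝ) :
    (coeffMatrix d p δ * vecMulVec v v).trace =
      (p * (∑ a, monomial a.1 (v a)) ^ 2).coeff δ := by
  classical
  rw [trace_mul_vecMulVec, sq, Finset.sum_mul_sum, Finset.mul_sum, coeff_sum]
  refine Finset.sum_congr rfl fun a _ ↦ ?_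
  rw [Finset.mul_sum, coeff_sum]
  refine Finset.sum_congr rfl fun b _ ↦ ?_
  rw [monomial_mul, coeff_mul_monomial_eq_sum, coeffMatrix, Matrix.of_apply, Finset.sum_mul]
  exact Finset.sum_congr rfl fun γ _ ↦ by rw [ite_mul, zero_mul]

/-- Products of a constraint and a square of bounded degree lie in the quadratic module. -/
theorem truncation_mul_sq_mem (g : Fin m → MvPolynomial (Fin n) ℝ) (d : ℕ) (i : Fin (m + 1))
    {s : MvPolynomial (Fin n) ℝ} (hs : s.totalDegree ≤ d - halfDegree (constraints g i)) :
    truncation n (2 * d) (constraints g i * s ^ 2) ∈ sosCone g d := by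
  classical
  refine ⟨Pi.single i (vecMulVec (fun a ↦ s.coeff a.1) (fun a ↦ s.coeff a.1)), fun j ↦ ?_, ?_⟩
  · obtain rfl | h := eq_or_ne j i
    · rw [Pi.single_eq_same]
      exact posSemidef_vecMulVec_self_star _
    · rw [Pi.single_eq_of_ne h]
      exact .zero
  · ext α
    rw [sosMap_apply, Finset.sum_eq_single i, Pi.single_eq_same,
      trace_coeffMatrix_mul_vecMulVec, sum_monomial_coeff hs, truncation_apply]
    · intro j _ h
      rw [Pi.single_eq_of_ne h]
      simp
    · simp

theorem truncation_sq_mem (g : Fin m → MvPolynomial (Fin n) ℝ) (d : ℕ)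
    {s : MvPolynomial (Fin n) ℝ} (hs : s.totalDegree ≤ d) :
    truncation n (2 * d) (s ^ 2) ∈ sosCone g d := by
  have := truncation_mul_sq_mem g d 0 (s := s) (by simpa [constraints, halfDegree] using hs)
  simpa [constraints] using this

/-! ### The order unit from the ball constraint -/

theorem halfDegree_ball_le (n : ℕ) (R : ℝ) :
    halfDegree (C (R ^ 2) - ∑ i : Fin n, X i ^ 2 : MvPolynomial (Fin n) ℝ) ≤ 1 := by
  have h : (C (R ^ 2) - ∑ i : Fin n, X i ^ 2 : MvPolynomial (Fin n) ℝ).totalDegree ≤ 2 := by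
    refine (totalDegree_sub _ _).trans (max_le ((totalDegree_C _).trans_le zero_le_two) ?_)
    exact totalDegree_finsetSum_le fun i _ ↦ (totalDegree_X_pow i 2).le
  rw [halfDegree]
  omega

/-- The even monomials are bounded above modulo the quadratic module. -/
theorem exists_bound_monomial_sq {g : Fin m → MvPolynomial (Fin n) ℝ}
    (hball : HasBallConstraint g) {d : ℕ} (α : Fin n →₀ ℕ)
    (hα : α.degree ≤ d) :
    ∃ N : ℝ, N • truncation n (2 * d) 1 - truncation n (2 * d) (monomial α 1 ^ 2) ∈
      sosCone g d := by
  classical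
  obtain ⟨j, R, hj⟩ := hball
  induction hk : α.degree generalizing α with
  | zero =>
    obtain rfl := (Finsupp.degree_eq_zero_iff α).1 hk
    exact ⟨1, by simp⟩
  | succ k ih =>
    obtain ⟨i, hi⟩ : ∃ i, α i ≠ 0 := by
      by_contra! h
      obtain rfl : α = 0 := Finsupp.ext h
      simp at hk
    obtain ⟨β, rfl⟩ : ∃ β, α = β + Finsupp.single i 1 :=
      ⟨α - Finsupp.single i 1, (tsub_add_cancel_of_le (by simpa [Nat.one_le_iff_ne_zero])).symm⟩
    simp only [map_add, Finsupp.degree_single, add_left_inj] at hk hα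
    obtain ⟨N, hN⟩ := ih β (by omega) hk
    -- With b = x^β: R²N - xᵢ²b² = R²(N - b²) + (R² - ∑ xₗ²)b² + ∑_{l ≠ i} xₗ²b².
    refine ⟨R ^ 2 * N, ?_⟩
    have hdeg (l : Fin n) : (X l * monomial β 1 : MvPolynomial (Fin n) ℝ).totalDegree ≤ d := by
      rw [X, monomial_mul]
      refine (totalDegree_monomial_le _ _).trans ?_
      change (Finsupp.single l 1 + β).degree ≤ d
      rw [map_add, Finsupp.degree_single]
      omega
    have h1 := (sosCone g d).smul_mem (sq_nonneg R) hN
    have h2 : truncation n (2 * d) (g j * monomial β 1 ^ 2) ∈ sosCone g d := by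
      have hg : constraints g j.succ = g j := by simp [constraints]
      have := truncation_mul_sq_mem g d j.succ (s := monomial β 1) (by
        rw [hg]
        refine (totalDegree_monomial_le _ _).trans ?_
        have := halfDegree_ball_le n R
        rw [← hj] at this
        change β.degree ≤ _
        omega)
      rwa [hg] at this
    have h3 : ∑ l ∈ Finset.univ.erase i, truncation n (2 * d) ((X l * monomial β 1) ^ 2) ∈
        sosCone g d :=
      Submodule.sum_mem _ fun l _ ↦ truncation_sq_mem g d (hdeg l)
    convert add_mem (add_mem h1 h2) h3 using 1
    have hmon : monomial (β + Finsupp.single i 1) (1 : ℝ) = X i * monomial β 1 := by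
      rw [X, monomial_mul, one_mul, add_comm]
    rw [← map_sum, smul_sub, smul_smul, ← map_smul, ← map_smul, ← map_sub,
      ← map_sub, ← map_add, ← map_add, hmon, hj,
      ← Finset.add_sum_erase _ (fun l ↦ (X l : MvPolynomial (Fin n) ℝ) ^ 2) (Finset.mem_univ i)]
    congr 1
    simp only [mul_pow, ← Finset.sum_mul, smul_eq_C_mul, map_pow, map_mul]
    ring

theorem exists_add_eq_of_degree_le {d : ℕ} (γ : Fin n →₀ ℕ) (hγ : γ.degree ≤ 2 * d) :
    ∃ α β : Fin n →₀ ℕ, α.degree ≤ d ∧ β.degree ≤ d ∧ α + β = γ := by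
  obtain ⟨α, hα, h⟩ := Finsupp.exists_le_degree_eq γ (γ.degree / 2) (by omega)
  obtain ⟨β, rfl⟩ := exists_add_of_le hα
  rw [map_add] at *
  exact ⟨α, β, by omega, by omega, rfl⟩

/-- Under the ball constraint, `1` is an order unit of the truncated quadratic module. -/
theorem exists_smul_one_sub_mem {g : Fin m → MvPolynomial (Fin n) ℝ}
    (hball : HasBallConstraint g) {d : ℕ}
    (x : MultiIndex n (2 * d) → ℝ) :
    ∃ N : ℝ, N • truncation n (2 * d) 1 - x ∈ sosCone g d := by
  have hmon (γ : MultiIndex n (2 * d)) (c : ℝ) : ∃ N : ℝ,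
      N • truncation n (2 * d) 1 - c • truncation n (2 * d) (monomial γ.1 1) ∈ sosCone g d := by
    obtain ⟨γ, hγ⟩ := γ
    obtain ⟨α, β, hα, hβ, rfl⟩ := exists_add_eq_of_degree_le γ hγ
    obtain ⟨N₁, h₁⟩ := exists_bound_monomial_sq hball α hα
    obtain ⟨N₂, h₂⟩ := exists_bound_monomial_sq hball β hβ
    have h₃ : truncation n (2 * d) ((monomial α 1 - C c * monomial β 1) ^ 2) ∈ sosCone g d :=
      truncation_sq_mem g d (by
        rw [C_mul_monomial, mul_one]
        refine (totalDegree_sub _ _).trans (max_le ?_ ?_)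
        · exact (totalDegree_monomial_le _ _).trans hα
        · exact (totalDegree_monomial_le _ _).trans hβ)
    -- From c x^(α+β) = ½(x^(2α) + c² x^(2β) - (x^α - c x^β)²), valid for either sign of c.
    refine ⟨1 / 2 * N₁ + c ^ 2 / 2 * N₂, ?_⟩
    have hc : 0 ≤ c ^ 2 / 2 := by positivity
    convert add_mem (add_mem ((sosCone g d).smul_mem (r := 1 / 2) (by norm_num) h₁)
      ((sosCone g d).smul_mem hc h₂))
      ((sosCone g d).smul_mem (r := 1 / 2) (by norm_num) h₃) using 1
    have hmul : monomial (α + β) (1 : ℝ) = monomial α 1 * monomial β 1 := by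
      rw [monomial_mul, one_mul]
    have hsq : (monomial α 1 - C c * monomial β 1) ^ 2 = monomial α (1 : ℝ) ^ 2 -
        (2 * c) • monomial (α + β) 1 + c ^ 2 • monomial β 1 ^ 2 := by
      rw [hmul]
      simp only [smul_eq_C_mul, map_mul, map_pow, map_ofNat]
      ring
    rw [hsq, map_add, map_sub, map_smul, map_smul]
    module
  choose N hN using fun γ ↦ hmon γ (x γ)
  refine ⟨∑ γ, N γ, ?_⟩
  rw [eq_sum_smul_truncation_monomial x, Finset.sum_smul, ← Finset.sum_sub_distrib]
  exact Submodule.sum_mem _ fun γ _ ↦ hN γ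

/-! ### Weak and strong duality -/

theorem primalObjective_nonneg_of_mem_sosCone {g : Fin m → MvPolynomial (Fin n) ℝ} {d : ℕ}
    {x y : MultiIndex n (2 * d) → ℝ} (hx : x ∈ sosCone g d) (hy : y ∈ primalFeasible g d) :
    0 ≤ ∑ α, x α * y α := by
  obtain ⟨Z, hZ, rfl⟩ := hx
  rw [sum_sosMap_mul]
  exact Finset.sum_nonneg fun i _ ↦ trace_mul_nonneg (hy.2 i) (hZ i)

theorem sum_truncation_one_mul {k : ℕ} (y : MultiIndex n k → ℝ) :
    ∑ α, truncation n k 1 α * y α = y (MultiIndex.zero n k) := by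
  classical
  have := sum_entry y 0 1
  simp only [truncation_apply, coeff_one]
  rw [this]
  simp [entry, MultiIndex.zero]

theorem localizingMatrix_isHermitian (d : ℕ) (p : MvPolynomial (Fin n) ℝ)
    (y : MultiIndex n (2 * d) → ℝ) : (localizingMatrix d p y).IsHermitian := by
  ext a b
  simp [localizingMatrix, add_comm]

/-- A sequence that is nonnegative on the quadratic module has positive semidefinite localizing
matrices. -/
theorem mem_primalFeasible_of_nonneg {g : Fin m → MvPolynomial (Fin n) ℝ} {d : ℕ}
    {y : MultiIndex n (2 * d) → ℝ} (hy0 : y (MultiIndex.zero n (2 * d)) = 1)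
    (hy : ∀ x ∈ sosCone g d, 0 ≤ ∑ α, x α * y α) : y ∈ primalFeasible g d := by
  classical
  refine ⟨hy0, fun i ↦ .of_dotProduct_mulVec_nonneg (localizingMatrix_isHermitian _ _ _)
    fun v ↦ ?_⟩
  -- Testing on v vᵀ in block i alone gives the quadratic form of the i-th localizing matrix at v.
  have := hy _ (mem_sosCone.2 ⟨Pi.single i (vecMulVec v v), fun j ↦ ?_, rfl⟩)
  · rw [sum_sosMap_mul, Finset.sum_eq_single i, Pi.single_eq_same, trace_mul_vecMulVec] at this
    · refine this.trans_eq ?_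
      simp only [dotProduct, mulVec, Finset.mul_sum]
      exact Finset.sum_congr rfl fun a _ ↦ Finset.sum_congr rfl fun b _ ↦ by
        rw [show star v = v from rfl]
        ring
    · intro j _ h
      rw [Pi.single_eq_of_ne h, Matrix.mul_zero, Matrix.trace_zero]
    · simp
  · obtain rfl | h := eq_or_ne j i
    · rw [Pi.single_eq_same]
      exact posSemidef_vecMulVec_self_star _
    · rw [Pi.single_eq_of_ne h]
      exact .zero

theorem valD_le_valP (f : MvPolynomial (Fin n) ℝ) (g : Fin m → MvPolynomial (Fin n) ℝ) (d : ℕ) :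
    valD f g d ≤ valP f g d := by
  refine iSup₂_le fun w hw ↦ le_iInf₂ fun y hy ↦ EReal.coe_le_coe_iff.2 ?_
  have := primalObjective_nonneg_of_mem_sosCone (exists_mem_dualFeasible_iff.1 ⟨w.2, hw⟩) hy
  simp only [Pi.sub_apply, Pi.smul_apply, smul_eq_mul, sub_mul, Finset.sum_sub_distrib,
    mul_assoc, ← Finset.mul_sum, sum_truncation_one_mul, hy.1, mul_one] at this
  exact sub_nonneg.1 this

theorem bot_lt_valD (f : MvPolynomial (Fin n) ℝ) {g : Fin m → MvPolynomial (Fin n) ℝ}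
    (hball : HasBallConstraint g) (d : ℕ) : ⊥ < valD f g d := by
  -- The order unit dominates -f, so f + N ∈ Q and z = -N is dual feasible.
  obtain ⟨N, hN⟩ := exists_smul_one_sub_mem hball (-truncation n (2 * d) f)
  obtain ⟨Z, hZ⟩ := exists_mem_dualFeasible_iff (f := f) (z := -N).2 (by
    convert hN using 1
    module)
  exact (EReal.bot_lt_coe (-N)).trans_le
    (le_iSup₂ (f := fun (w : ℝ × DualMatrices g d) (_ : w ∈ dualFeasible f g d) ↦ (w.1 : EReal))
      _ hZ)

theorem valP_le_valD (f : MvPolynomial (Fin n) ℝ) {g : Fin m → MvPolynomial (Fin n) ℝ}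
    (hball : HasBallConstraint g) (d : ℕ) :
    valP f g d ≤ valD f g d := by
  classical
  refine EReal.le_of_forall_lt_iff_le.1 fun c hc ↦ ?_
  obtain ⟨L, hL1, hL, hLf⟩ := exists_state_le (sosCone g d) (truncation n (2 * d) 1)
    (exists_smul_one_sub_mem hball) (truncation n (2 * d) f) c (fun t ht h ↦ by
    obtain ⟨Z, hZ⟩ := exists_mem_dualFeasible_iff.2 h
    exact (hc.trans (EReal.coe_lt_coe_iff.2 ht)).not_ge
      (le_iSup₂ (f := fun (w : ℝ × DualMatrices g d) (_ : w ∈ dualFeasible f g d) ↦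
        (w.1 : EReal)) _ hZ))
  -- L is determined by its moments y_α = L(x^α), which form the primal point.
  have hLy (x : MultiIndex n (2 * d) → ℝ) :
      L x = ∑ α, x α * L (truncation n (2 * d) (monomial α.1 1)) := by
    conv_lhs => rw [eq_sum_smul_truncation_monomial x]
    simp
  have hy : (fun α : MultiIndex n (2 * d) ↦ L (truncation n (2 * d) (monomial α.1 1))) ∈
      primalFeasible g d :=
    mem_primalFeasible_of_nonneg hL1 fun x hx ↦ hLy x ▸ hL x hx
  refine (iInf₂_le _ hy).trans (EReal.coe_le_coe_iff.2 ?_)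
  rw [hLy] at hLf
  exact hLf

end Truncation

end Lasserre

theorem mainTheorem1 {n m : ℕ} (f : MvPolynomial (Fin n) ℝ)
    (g : Fin m → MvPolynomial (Fin n) ℝ) (hball : Lasserre.HasBallConstraint g)
    (d : ℕ) (hd : Lasserre.minOrder g ≤ d) :
    ⊥ < Lasserre.valP f g d ∧
      Lasserre.valP f g d = Lasserre.valD f g d ∧
      (Lasserre.primalFeasible g d = ∅ →
        Lasserre.valP f g d = ⊤ ∧ Lasserre.valD f g d = ⊤) := by
  have heq : Lasserre.valP f g d = Lasserre.valD f g d :=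
    (Lasserre.valP_le_valD f hball d).antisymm (Lasserre.valD_le_valP f g d)
  refine ⟨heq ▸ Lasserre.bot_lt_valD f hball d, heq, fun h ↦ ?_⟩
  have htop : Lasserre.valP f g d = ⊤ := by simp [Lasserre.valP, h]
  exact ⟨htop, heq ▸ htop⟩
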